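/- Let $K$ be a field, $G$ a finite simple graph with vertex set $V$, and $R=K[x_v : v\in V]$. For an integer $r\ge 1$ let $$I_r(G)=\Big(\prod_{v\in S}x_v \;\Big|\; S\subseteq V,\ |S|=r+1,\ G[S]\text{ connected}\Big)\subseteq R .$$ A homogeneous ideal $I\subseteq R$ has a linear resolution if, for some $d$, its minimal graded free resolution has the form $0\to R(-d-p)^{\beta_p}\to\cdots\to R(-d-1)^{\beta_1}\to R(-d)^{\beta_0}\to I\to 0$ (the zero ideal is included, with all $\beta_i=0$). A monomial ideal $I$ generated in a single degree, with minimal set of monomial generators $\mathcal G(I)$, is polymatroidal if for all $u,v\in\mathcal G(I)$ and every $i$ with $\deg_{x_i}(u)>\deg_{x_i}(v)$ there is $j$ with $\deg_{x_j}(u)<\deg_{x_j}(v)$ and $x_j u/x_i\in\mathcal G(I)$ (again the zero ideal is included). Theorem. In each of the following cases $I_r(G)$ is polymatroidal, and $I_r(G)^q$ has a linear resolution for every integer $q\ge 1$: 1. $r\ge 1$ and $G$ is isomorphic to a complete multipartite graph $K_{n_1,\dots,n_p}$ with all $n_i\ge 1$; 2. $r\ge 3$ and $G$ is isomorphic to the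 complement of the cycle $C_n$, for some $n\ge 3$; 3. $r\ge 1$ and $G$ is isomorphic to $\Gamma_{p,m_1,\dots,m_n}$ with $p\ge 1$ and $1\le m_i\le r$ for all $i$, where $\Gamma_{p,m_1,\dots,m_n}$ has the distinct vertices $x_1,\dots,x_p$ and $y_{ij}$ ($1\le i\le n$, $1\le j\le m_i$), and two different vertices are adjacent if and only if both lie in $\{x_1,\dots,x_p,y_{i1},\dots,y_{im_i}\}$ for some $i$. -/

import Mathlib

open MvPolynomial

/-- The ideal `I_r(G)` in `K[x_v : v ∈ V]`, generated by the squarefree monomials `∏_{x ∈ S} x`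
over all `(r+1)`-subsets `S` of vertices such that the induced subgraph `G[S]` is connected. -/
noncomputable def connectedIdeal (K : Type*) [Field K] {V : Type*} (G : SimpleGraph V) (r : ℕ) :
    Ideal (MvPolynomial V K) :=
  Ideal.span {f | ∃ S : Finset V, S.card = r + 1 ∧ (G.induce (S : Set V)).Connected ∧
    f = ∏ x ∈ S, X x}

/-- A graded free resolution of finite length
`0 ⟶ F_p ⟶ ⋯ ⟶ F_1 ⟶ F_0 ⟶ I ⟶ 0` by finitely generated graded free modules
`F_i = ⊕_{k < rank i} R(-shift i k)`, where `R = K[x_v : v ∈ V]`.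
The augmentation `F_0 ⟶ I` sends the `k`-th basis vector to `gen k`, and the differential
`F_{i+1} ⟶ F_i` is multiplication by the matrix `diff i`. All maps are of degree zero. -/
structure GradedFreeResolution {K : Type*} [Field K] {V : Type*}
    (I : Ideal (MvPolynomial V K)) where
  /-- the rank of `F_i` -/
  rank : ℕ → ℕ
  /-- the degrees of the basis vectors of `F_i` -/
  shift : (i : ℕ) → Fin (rank i) → ℕ
  /-- the images in `I` of the basis vectors of `F_0` -/
  gen : Fin (rank 0) → MvPolynomial V K
  /-- the matrix of the differential `F_{i+1} ⟶ F_i` -/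
  diff : (i : ℕ) → Matrix (Fin (rank i)) (Fin (rank (i + 1))) (MvPolynomial V K)
  gen_homogeneous : ∀ k, (gen k).IsHomogeneous (shift 0 k)
  diff_homogeneous : ∀ i k l, diff i k l = 0 ∨
    ∃ e : ℕ, shift (i + 1) l = shift i k + e ∧ (diff i k l).IsHomogeneous e
  span_gen : Ideal.span (Set.range gen) = I
  exact_zero : LinearMap.range (diff 0).mulVecLin =
    LinearMap.ker (Fintype.linearCombination (MvPolynomial V K) gen)
  exact_succ : ∀ i, LinearMap.range (diff (i + 1)).mulVecLin = LinearMap.ker (diff i).mulVecLin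
  finite_length : ∃ p, ∀ i, p < i → rank i = 0

namespace GradedFreeResolution

variable {K : Type*} [Field K] {V : Type*} {I : Ideal (MvPolynomial V K)}

/-- The resolution is minimal: every differential `F_{i+1} ⟶ F_i` has its image in `𝔪 F_i`,
where `𝔪` is the ideal generated by the variables. -/
def IsMinimal (F : GradedFreeResolution I) : Prop :=
  ∀ i k l, constantCoeff (F.diff i k l) = 0

/-- The resolution is `d`-linear: `F_i = R(-d-i)^{rank i}` for every `i`. -/
def IsLinear (F : GradedFreeResolution I) (d : ℕ) : Prop :=
  ∀ i k, F.shift i k = d + i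

end GradedFreeResolution

/-- `I` has a linear resolution: for some `d`, its minimal graded free resolution
(which is unique up to isomorphism) is `d`-linear. -/
def HasLinearResolution {K : Type*} [Field K] {V : Type*} (I : Ideal (MvPolynomial V K)) : Prop :=
  ∃ (d : ℕ) (F : GradedFreeResolution I), F.IsMinimal ∧ F.IsLinear d

/-- The exponent vectors of the minimal monomial generators of a monomial ideal `I`, that is,
of the monomials of `I` that are minimal with respect to divisibility. -/
def minimalMonomials {K : Type*} [Field K] {V : Type*} (I : Ideal (MvPolynomial V K)) :
    Set (V →₀ ℕ) :=
  {a | Minimal (fun b : V →₀ ℕ => monomial b (1 : K) ∈ I) a}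

/-- A monomial ideal, generated in a single degree, whose minimal monomial generators satisfy the
exchange axiom. -/
structure IsPolymatroidal {K : Type*} [Field K] {V : Type*} (I : Ideal (MvPolynomial V K)) :
    Prop where
  isMonomial : ∃ A : Set (V →₀ ℕ), I = Ideal.span ((fun a => monomial a (1 : K)) '' A)
  singleDegree : ∃ d : ℕ, ∀ a ∈ minimalMonomials I, a.degree = d
  exchange : ∀ a ∈ minimalMonomials I, ∀ b ∈ minimalMonomials I, ∀ i, b i < a i →
    ∃ j, a j < b j ∧ a - Finsupp.single i 1 + Finsupp.single j 1 ∈ minimalMonomials I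

/-- The vertex set `{x_1, …, x_p} ∪ {y_{i1}, …, y_{i m_i}}` of the `i`-th of the complete graphs
that are glued. Here `Sum.inl k` is `x_k` and `Sum.inr ⟨i, j⟩` is `y_{ij}`. -/
def gluedClique (p : ℕ) {n : ℕ} (m : Fin n → ℕ) (i : Fin n) :
    Set (Fin p ⊕ (Σ i : Fin n, Fin (m i))) :=
  Set.range Sum.inl ∪ Set.range (fun j : Fin (m i) => Sum.inr ⟨i, j⟩)

/-- The graph `Γ_{p, m_1, …, m_n}`: the union of the complete graphs on the sets
`{x_1, …, x_p, y_{i1}, …, y_{i m_i}}`. -/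
def gluedCompleteGraph (p : ℕ) {n : ℕ} (m : Fin n → ℕ) :
    SimpleGraph (Fin p ⊕ (Σ i : Fin n, Fin (m i))) where
  Adj u v := u ≠ v ∧ ∃ i, u ∈ gluedClique p m i ∧ v ∈ gluedClique p m i
  symm := ⟨fun _ _ h => ⟨h.1.symm, h.2.imp fun _ hi => ⟨hi.2, hi.1⟩⟩⟩
  loopless := ⟨fun _ h => h.1 rfl⟩

/-! In all three cases some map `c` on the vertices decides connectedness: an `(r+1)`-set spans a
connected subgraph iff `c` is not constant on it, apart from degenerate cases with no such connected
set. For multipartite graphs `c` is the part; for complements of cycles of length at least 5 it is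
the identity; for the glued graph it fixes each `x_k` and identifies all `y_{ij}`. The sets of a
given size where `c` is not constant are the bases of a matroid (`basisExchange_nonconstant`), so
the ideal is polymatroidal.

Exchange survives Minkowski sums (`ExchangeProperty.add`), so every power is again generated by
monomials of one degree with the exchange property. Added in lexicographic order, such generators
have colon ideals generated by variables (`ExchangeProperty.exists_isLinearIdeal`). Each added
generator preserves linearity by the horseshoe lemma applied to syzygies (`IsLinearIdeal.sup_span`),
and a resolution by matrices of linear forms is automatically minimal. -/

/-! ### Linear resolutions and the horseshoe lemma -/

section LinearSyzygies

variable {K : Type*} [Field K] {V : Type*}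

lemma homogeneousComponent_mul_of_isHomogeneous {q : MvPolynomial V K} {e : ℕ}
    (hq : q.IsHomogeneous e) (p : MvPolynomial V K) (n : ℕ) :
    homogeneousComponent (n + e) (p * q) = homogeneousComponent n p * q := by
  conv_lhs => rw [← sum_homogeneousComponent p, Finset.sum_mul, map_sum]
  have key : ∀ i, homogeneousComponent (n + e) (homogeneousComponent i p * q) =
      if i = n then homogeneousComponent n p * q else 0 := by
    intro i
    rw [homogeneousComponent_of_mem
      ((mem_homogeneousSubmodule _ _).2 ((homogeneousComponent_isHomogeneous i p).mul hq))]
    by_cases h : i = n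
    · subst h; simp
    · simp [h, Ne.symm h]
  simp_rw [key, Finset.sum_ite_eq', Finset.mem_range]
  split_ifs with h
  · rfl
  · rw [homogeneousComponent_eq_zero _ _ (by omega), zero_mul]

/-- A submodule of a free module that contains all homogeneous components of its elements. -/
def IsGradedSubmodule {ι : Type} (N : Submodule (MvPolynomial V K) (ι → MvPolynomial V K)) :
    Prop :=
  ∀ v ∈ N, ∀ n, (fun i => homogeneousComponent n (v i)) ∈ N

/-- All entries have the same degree, so a relation splits by degree. Gradedness is what allows
homogeneous lifts in the horseshoe lemma. -/
lemma isGradedSubmodule_ker {ι κ : Type} [Fintype κ] {g : κ → ι → MvPolynomial V K} {e : ℕ}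
    (hg : ∀ k i, (g k i).IsHomogeneous e) :
    IsGradedSubmodule (LinearMap.ker (Fintype.linearCombination (MvPolynomial V K) g)) := by
  intro v hv n
  rw [LinearMap.mem_ker, Fintype.linearCombination_apply] at hv ⊢
  funext i
  have h := congrArg (homogeneousComponent (n + e)) (congrFun hv i)
  simp only [Finset.sum_apply, Pi.smul_apply, smul_eq_mul, map_sum, Pi.zero_apply, map_zero] at h ⊢
  rw [← h]
  exact Finset.sum_congr rfl fun k _ =>
    (homogeneousComponent_mul_of_isHomogeneous (hg k i) _ _).symm

/-- `N` is generated by vectors with entries homogeneous of degree `e`, and has a linear free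
resolution with at most `p` nonzero terms. -/
def HasLinearSyzygies : ℕ → {ι : Type} → Submodule (MvPolynomial V K) (ι → MvPolynomial V K) →
    ℕ → Prop
  | 0, _, N, _ => N = ⊥
  | p + 1, ι, N, e => ∃ (κ : Type) (_ : Fintype κ) (g : κ → ι → MvPolynomial V K),
      (∀ k i, (g k i).IsHomogeneous e) ∧
      LinearMap.range (Fintype.linearCombination (MvPolynomial V K) g) = N ∧
      HasLinearSyzygies p (LinearMap.ker (Fintype.linearCombination (MvPolynomial V K) g)) 1

lemma hasLinearSyzygies_bot (p : ℕ) {ι : Type} (e : ℕ) :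
    HasLinearSyzygies p (⊥ : Submodule (MvPolynomial V K) (ι → MvPolynomial V K)) e := by
  induction p generalizing ι e with
  | zero => rfl
  | succ p ih =>
    refine ⟨Empty, inferInstance, fun k => k.elim, fun k => k.elim, ?_, ?_⟩
    · rw [LinearMap.range_eq_bot]
      exact LinearMap.ext fun c => by simp [Fintype.linearCombination_apply]
    · convert ih 1
      exact Subsingleton.elim _ _

lemma HasLinearSyzygies.succ {p : ℕ} {ι : Type} {e : ℕ}
    {N : Submodule (MvPolynomial V K) (ι → MvPolynomial V K)} (h : HasLinearSyzygies p N e) :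
    HasLinearSyzygies (p + 1) N e := by
  induction p generalizing ι e with
  | zero =>
    change N = ⊥ at h
    subst h
    exact hasLinearSyzygies_bot _ _
  | succ p ih =>
    obtain ⟨κ, _, g, hg, hN, hk⟩ := h
    exact ⟨κ, _, g, hg, hN, ih hk⟩

lemma HasLinearSyzygies.mono {p q : ℕ} (hpq : p ≤ q) {ι : Type} {e : ℕ}
    {N : Submodule (MvPolynomial V K) (ι → MvPolynomial V K)} (h : HasLinearSyzygies p N e) :
    HasLinearSyzygies q N e := by
  induction hpq with
  | refl => exact h
  | step _ ih => exact ih.succ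

lemma sumElim_linearCombination {ι κ ι' κ' : Type} [Fintype ι'] [Fintype κ']
    (g₁ : ι' → ι → MvPolynomial V K) (h : κ' → ι → MvPolynomial V K)
    (g₂ : κ' → κ → MvPolynomial V K) (c : ι' ⊕ κ' → MvPolynomial V K) :
    Fintype.linearCombination (MvPolynomial V K)
      (Sum.elim (fun k => Sum.elim (g₁ k) 0) (fun k => Sum.elim (h k) (g₂ k))) c =
    Sum.elim (Fintype.linearCombination (MvPolynomial V K) g₁ (c ∘ Sum.inl) +
        Fintype.linearCombination (MvPolynomial V K) h (c ∘ Sum.inr))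
      (Fintype.linearCombination (MvPolynomial V K) g₂ (c ∘ Sum.inr)) := by
  ext i
  cases i <;> simp [Fintype.linearCombination_apply]

/-- The horseshoe lemma for linear resolutions. -/
theorem HasLinearSyzygies.horseshoe {p : ℕ} {ι κ : Type} {e : ℕ}
    {N : Submodule (MvPolynomial V K) (ι ⊕ κ → MvPolynomial V K)}
    {N₁ : Submodule (MvPolynomial V K) (ι → MvPolynomial V K)}
    {N₂ : Submodule (MvPolynomial V K) (κ → MvPolynomial V K)} (hN : IsGradedSubmodule N)
    (h₁ : ∀ x, x ∈ N₁ ↔ Sum.elim x 0 ∈ N) (h₂ : ∀ y, y ∈ N₂ ↔ ∃ x, Sum.elim x y ∈ N)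
    (hN₁ : HasLinearSyzygies p N₁ e) (hN₂ : HasLinearSyzygies p N₂ e) :
    HasLinearSyzygies p N e := by
  induction p generalizing ι κ e with
  | zero =>
    change N₁ = ⊥ at hN₁
    change N₂ = ⊥ at hN₂
    change N = ⊥
    rw [Submodule.eq_bot_iff]
    intro v hv
    rw [← Sum.elim_comp_inl_inr v] at hv ⊢
    have hr : v ∘ Sum.inr = 0 := by
      rw [← Submodule.mem_bot (MvPolynomial V K), ← hN₂, h₂]
      exact ⟨_, hv⟩
    rw [hr] at hv ⊢
    have hl : v ∘ Sum.inl = 0 := by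
      rwa [← Submodule.mem_bot (MvPolynomial V K), ← hN₁, h₁]
    rw [hl, Sum.elim_zero_zero]
  | succ p ih =>
    obtain ⟨ι', _, g₁, hg₁, rfl, hk₁⟩ := hN₁
    obtain ⟨κ', _, g₂, hg₂, rfl, hk₂⟩ := hN₂
    -- Any lift of `g₂ k` to `N` can be cut down to its degree `e` part, because `N` is graded.
    have lift : ∀ k, ∃ x : ι → MvPolynomial V K,
        (∀ i, (x i).IsHomogeneous e) ∧ Sum.elim x (g₂ k) ∈ N := by
      classical
      intro k
      obtain ⟨x, hx⟩ := (h₂ (g₂ k)).1 ⟨Pi.single k 1, by simp⟩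
      refine ⟨fun i => homogeneousComponent e (x i),
        fun i => homogeneousComponent_isHomogeneous _ _, ?_⟩
      convert hN _ hx e using 1
      ext i : 1
      cases i with
      | inl i => rfl
      | inr i => exact (homogeneousComponent_eq_self (hg₂ k i)).symm
    choose h hh hhN using lift
    have hg : ∀ k i, ((Sum.elim (fun k => Sum.elim (g₁ k) 0) (fun k => Sum.elim (h k) (g₂ k)) :
        ι' ⊕ κ' → ι ⊕ κ → MvPolynomial V K) k i).IsHomogeneous e := by
      rintro (k | k) (i | i)
      exacts [hg₁ k i, isHomogeneous_zero _ _ _, hh k i, hg₂ k i]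
    have hcomb : ∀ c, Sum.elim (Fintype.linearCombination (MvPolynomial V K) h c)
        (Fintype.linearCombination (MvPolynomial V K) g₂ c) ∈ N := by
      intro c
      have : Sum.elim (Fintype.linearCombination (MvPolynomial V K) h c)
          (Fintype.linearCombination (MvPolynomial V K) g₂ c) =
          ∑ k, c k • Sum.elim (h k) (g₂ k) := by
        ext i
        cases i <;> simp [Fintype.linearCombination_apply]
      rw [this]
      exact N.sum_mem fun k _ => N.smul_mem _ (hhN k)
    -- The new kernel is again an extension, of the syzygies of `g₂` by those of `g₁`, so the
    -- induction applies to it.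
    refine ⟨ι' ⊕ κ', inferInstance, _, hg, ?_, ih (isGradedSubmodule_ker hg) ?_ ?_ hk₁ hk₂⟩
    · apply le_antisymm
      · rintro _ ⟨c, rfl⟩
        rw [sumElim_linearCombination]
        have := N.add_mem ((h₁ _).1 ⟨c ∘ Sum.inl, rfl⟩) (hcomb (c ∘ Sum.inr))
        rwa [← Sum.elim_add_add, zero_add] at this
      · intro v hv
        obtain ⟨c₂, hc₂⟩ := (h₂ (v ∘ Sum.inr)).2 ⟨v ∘ Sum.inl, by rwa [Sum.elim_comp_inl_inr]⟩
        have := N.sub_mem hv (hcomb c₂)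
        rw [← Sum.elim_comp_inl_inr v, ← Sum.elim_sub_sub, hc₂, sub_self, ← h₁] at this
        obtain ⟨c₁, hc₁⟩ := this
        refine ⟨Sum.elim c₁ c₂, ?_⟩
        rw [sumElim_linearCombination, Sum.elim_comp_inl, Sum.elim_comp_inr, hc₁, hc₂,
          sub_add_cancel, Sum.elim_comp_inl_inr]
    · intro x
      rw [LinearMap.mem_ker, LinearMap.mem_ker, sumElim_linearCombination, Sum.elim_comp_inl,
        Sum.elim_comp_inr, map_zero, map_zero, add_zero, ← Sum.elim_zero_zero]
      exact ⟨fun h => by rw [h], fun h => by simpa using congrArg (· ∘ Sum.inl) h⟩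
    · intro y
      simp only [LinearMap.mem_ker, sumElim_linearCombination, Sum.elim_comp_inl,
        Sum.elim_comp_inr]
      constructor
      -- For a syzygy of `g₂`, the combination of the lifts lies in `N₁`, so subtracting a
      -- combination of `g₁` makes it a syzygy of all generators.
      · intro hy
        have hm := hcomb y
        rw [hy, ← h₁] at hm
        obtain ⟨c, hc⟩ := hm
        exact ⟨-c, by rw [map_neg, hc, hy, neg_add_cancel, Sum.elim_zero_zero]⟩
      · rintro ⟨x, hx⟩
        simpa using congrArg (· ∘ Sum.inr) hx

/-- `I` is generated in degree `d` and has a linear resolution (with at most `p + 1` terms). -/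
def IsLinearIdeal (p d : ℕ) (I : Ideal (MvPolynomial V K)) : Prop :=
  ∃ (ι : Type) (_ : Fintype ι) (u : ι → MvPolynomial V K), (∀ k, (u k).IsHomogeneous d) ∧
    Ideal.span (Set.range u) = I ∧
    HasLinearSyzygies p (LinearMap.ker (Fintype.linearCombination (MvPolynomial V K) u)) 1

lemma isLinearIdeal_bot (p d : ℕ) : IsLinearIdeal p d (⊥ : Ideal (MvPolynomial V K)) := by
  refine ⟨Empty, inferInstance, fun k => k.elim, fun k => k.elim, by simp, ?_⟩
  convert hasLinearSyzygies_bot p 1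
  exact Subsingleton.elim _ _

lemma IsLinearIdeal.mono {p q d : ℕ} (hpq : p ≤ q) {I : Ideal (MvPolynomial V K)}
    (h : IsLinearIdeal p d I) : IsLinearIdeal q d I := by
  obtain ⟨ι, _, u, hu, hI, hk⟩ := h
  exact ⟨ι, _, u, hu, hI, hk.mono hpq⟩

lemma ker_linearCombination_const {ι κ : Type} [Fintype ι] [Nonempty κ]
    (u : ι → MvPolynomial V K) :
    LinearMap.ker (Fintype.linearCombination (MvPolynomial V K)
      (fun k => (fun _ => u k : κ → MvPolynomial V K))) =
    LinearMap.ker (Fintype.linearCombination (MvPolynomial V K) u) := by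
  ext c
  simp [Fintype.linearCombination_apply, funext_iff]

/-- Adding a generator `w` to an ideal with linear resolution keeps this property if the colon
ideal is generated by linear forms and has a linear resolution. -/
lemma IsLinearIdeal.sup_span {p d : ℕ} {I L : Ideal (MvPolynomial V K)}
    {w : MvPolynomial V K} (hI : IsLinearIdeal (p + 1) d I) (hw : w.IsHomogeneous d)
    (hL : IsLinearIdeal p 1 L) (hcolon : ∀ c, c ∈ L ↔ c * w ∈ I) :
    IsLinearIdeal (p + 1) d (I ⊔ Ideal.span {w}) := by
  obtain ⟨ι, _, u, hu, rfl, hk⟩ := hI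
  obtain ⟨κ, _, x, hx, rfl, hkx⟩ := hL
  refine ⟨ι ⊕ Unit, inferInstance, Sum.elim u fun _ => w, ?_, ?_, ?_⟩
  · rintro (k | k)
    exacts [hu k, hw]
  · rw [Set.Sum.elim_range, Ideal.span_union, Set.range_const]
  · have hker : IsGradedSubmodule (LinearMap.ker
        (Fintype.linearCombination (MvPolynomial V K) (Sum.elim u fun _ : Unit => w))) := by
      rw [← ker_linearCombination_const (κ := Unit)]
      exact isGradedSubmodule_ker (e := d) (by rintro (k | k) i; exacts [hu k, hw])
    -- Syzygies of `(u, w)` with zero last entry are the syzygies of `u`; the last entries that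
    -- occur form the colon ideal `L`, seen inside a free module of rank one.
    refine HasLinearSyzygies.horseshoe (N₂ := LinearMap.range
        (Fintype.linearCombination (MvPolynomial V K) fun k => (fun _ : Unit => x k)))
      hker ?_ ?_ hk ⟨κ, inferInstance, fun k _ => x k, fun k _ => hx k, rfl, ?_⟩
    · intro y
      simp only [LinearMap.mem_ker, Fintype.linearCombination_apply, Fintype.sum_sum_type,
        Sum.elim_inl, Sum.elim_inr, Pi.zero_apply, zero_smul, Finset.sum_const_zero, add_zero]
    · intro y
      have e1 : y ∈ LinearMap.range (Fintype.linearCombination (MvPolynomial V K)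
          fun k => (fun _ : Unit => x k)) ↔ y () ∈ Ideal.span (Set.range x) := by
        rw [Ideal.mem_span_range_iff_exists_fun, LinearMap.mem_range]
        simp only [Fintype.linearCombination_apply, funext_iff, Finset.sum_apply, Pi.smul_apply,
          smul_eq_mul]
        exact exists_congr fun c => ⟨fun h => h (), fun h _ => h⟩
      rw [e1, hcolon, Ideal.mem_span_range_iff_exists_fun]
      simp only [LinearMap.mem_ker, Fintype.linearCombination_apply, Fintype.sum_sum_type,
        Sum.elim_inl, Sum.elim_inr, smul_eq_mul, Finset.univ_unique, Finset.sum_singleton]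
      constructor
      · rintro ⟨c, hc⟩
        exact ⟨-c, by simp [hc]⟩
      · rintro ⟨c, hc⟩
        exact ⟨-c, by simp [eq_neg_of_add_eq_zero_left hc]⟩
    · rwa [ker_linearCombination_const]

/-- Variables are added one at a time: for `v ∉ T`, multiplication by `X v` is injective modulo the
variables in `T`, so the colon ideal is the ideal already built. -/
lemma isLinearIdeal_span_X (T : Finset V) :
    ∃ p, IsLinearIdeal p 1 (Ideal.span (X '' (T : Set V)) : Ideal (MvPolynomial V K)) := by
  classical
  induction T using Finset.induction_on with
  | empty => exact ⟨0, by simpa using isLinearIdeal_bot 0 1⟩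
  | insert v T hv ih =>
    obtain ⟨p, hp⟩ := ih
    refine ⟨p + 1, ?_⟩
    rw [Finset.coe_insert, Set.image_insert_eq, Set.insert_eq, Ideal.span_union, sup_comm]
    refine (hp.mono p.le_succ).sup_span (isHomogeneous_X _ _) hp fun c => ?_
    rw [mem_ideal_span_X_image, mem_ideal_span_X_image, support_mul_X]
    simp only [Finset.mem_map, addRightEmbedding_apply, forall_exists_index, and_imp,
      forall_apply_eq_imp_iff₂]
    refine forall₂_congr fun m _ => exists_congr fun i => and_congr_right fun hi => ?_
    have : v ≠ i := fun h => hv (h ▸ hi)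
    simp [this]

end LinearSyzygies

/-! ### Exchange property, Minkowski sums and powers -/

section Exchange

variable {V : Type*}

/-- The exchange axiom of a polymatroidal ideal, for a set of exponent vectors. -/
def ExchangeProperty (A : Set (V →₀ ℕ)) : Prop :=
  ∀ a ∈ A, ∀ b ∈ A, ∀ i, b i < a i →
    ∃ j, a j < b j ∧ a - Finsupp.single i 1 + Finsupp.single j 1 ∈ A

/-- The additive form of a swap avoids truncated subtraction. -/
lemma ExchangeProperty.exists_swap {A : Set (V →₀ ℕ)} (hA : ExchangeProperty A) {a b : V →₀ ℕ}
    (ha : a ∈ A) (hb : b ∈ A) {i : V} (hi : b i < a i) :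
    ∃ j, a j < b j ∧ ∃ a' ∈ A, a' + Finsupp.single i 1 = a + Finsupp.single j 1 := by
  obtain ⟨j, hj, h⟩ := hA a ha b hb i hi
  refine ⟨j, hj, _, h, ?_⟩
  have : Finsupp.single i 1 ≤ a := by
    rw [Finsupp.single_le_iff]
    omega
  rw [add_right_comm, tsub_add_cancel_of_le this]

lemma exchangeProperty_of_exists_swap {A : Set (V →₀ ℕ)}
    (h : ∀ a ∈ A, ∀ b ∈ A, ∀ i, b i < a i →
      ∃ j, a j < b j ∧ ∃ a' ∈ A, a' + Finsupp.single i 1 = a + Finsupp.single j 1) :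
    ExchangeProperty A := by
  intro a ha b hb i hi
  obtain ⟨j, hj, a', ha', e⟩ := h a ha b hb i hi
  refine ⟨j, hj, ?_⟩
  have : Finsupp.single i 1 ≤ a := by
    rw [Finsupp.single_le_iff]
    omega
  convert ha'
  apply add_right_cancel (b := Finsupp.single i 1)
  rw [e, add_right_comm, tsub_add_cancel_of_le this]

lemma swap_apply [DecidableEq V] {a a' : V →₀ ℕ} {i j : V}
    (e : a' + Finsupp.single i 1 = a + Finsupp.single j 1) (v : V) :
    a' v + (if i = v then 1 else 0) = a v + (if j = v then 1 else 0) := by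
  simpa [Finsupp.single_apply] using DFunLike.congr_fun e v

/-- Both changed coordinates move towards `b`; this is the descent in the proof for Minkowski sums.
-/
lemma sum_dist_lt_of_swap [Fintype V] {a a' b : V →₀ ℕ} {i j : V} (hi : b i < a i)
    (hj : a j < b j) (e : a' + Finsupp.single i 1 = a + Finsupp.single j 1) :
    ∑ v, Nat.dist (a' v) (b v) < ∑ v, Nat.dist (a v) (b v) := by
  classical
  have hij : i ≠ j := by rintro rfl; omega
  have h := swap_apply e
  refine Finset.sum_lt_sum (fun v _ => ?_) ⟨i, Finset.mem_univ _, ?_⟩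
  · have hv := h v
    unfold Nat.dist
    by_cases h1 : i = v
    · subst h1; simp [hij.symm] at hv; omega
    · by_cases h2 : j = v
      · subst h2; simp [hij] at hv; omega
      · simp [h1, h2] at hv; omega
  · have hv := h i
    simp [hij.symm] at hv
    unfold Nat.dist
    omega

open Pointwise in
/-- The Minkowski sum of two sets with the exchange property has the exchange property. -/
theorem ExchangeProperty.add [Finite V] {A B : Set (V →₀ ℕ)} (hA : ExchangeProperty A)
    (hB : ExchangeProperty B) : ExchangeProperty (A + B) := by
  classical
  have := Fintype.ofFinite V
  apply exchangeProperty_of_exists_swap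
  rintro _ ⟨a₀, ha₀, b₀, hb₀, rfl⟩ _ ⟨y, hy, z, hz, rfl⟩
  suffices H : ∀ n, ∀ a ∈ A, ∀ b ∈ B, ∑ v, Nat.dist (a v) (y v) + ∑ v, Nat.dist (b v) (z v) = n →
      ∀ i, y i + z i < a i + b i → ∃ j, a j + b j < y j + z j ∧ ∃ a' ∈ A + B,
        a' + Finsupp.single i 1 = (a + b) + Finsupp.single j 1 from
    H _ a₀ ha₀ b₀ hb₀ rfl
  intro n
  induction n using Nat.strong_induction_on with
  | _ n ih =>
    intro a ha b hb hn i hi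
    -- If a swap increases a coordinate `j` that was not deficient, the new pair has a surplus at
    -- `j` and is closer to `(y, z)`. Induction then moves this surplus to a deficient `l`, and the
    -- two swaps compose to one from `i` to `l`.
    have step : ∀ a' ∈ A, ∀ b' ∈ B, ∀ j, i ≠ j →
        (a' + b') + Finsupp.single i 1 = (a + b) + Finsupp.single j 1 →
        ∑ v, Nat.dist (a' v) (y v) + ∑ v, Nat.dist (b' v) (z v) < n →
        ∃ j, a j + b j < y j + z j ∧ ∃ a' ∈ A + B,
          a' + Finsupp.single i 1 = (a + b) + Finsupp.single j 1 := by
      intro a' ha' b' hb' j hij e hlt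
      by_cases hj : a j + b j < y j + z j
      · exact ⟨j, hj, _, Set.add_mem_add ha' hb', e⟩
      · have hs := swap_apply e
        have hsj := hs j
        have hsi := hs i
        simp only [Finsupp.add_apply, hij, hij.symm, if_true, if_false] at hsj hsi
        obtain ⟨l, hl, c, hc, ec⟩ := ih _ hlt a' ha' b' hb' rfl j (by omega)
        have hsl := hs l
        simp only [Finsupp.add_apply] at hsl
        have hil : i ≠ l := by rintro rfl; omega
        rw [if_neg hil] at hsl
        refine ⟨l, by omega, c, hc, ?_⟩
        apply add_right_cancel (b := Finsupp.single j 1)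
        rw [add_right_comm, ec, add_right_comm, e, add_right_comm]
    -- A surplus of the sum at `i` forces a surplus of one of the summands.
    rcases lt_or_ge (y i) (a i) with h | h
    · obtain ⟨j, hj, a', ha', e⟩ := hA.exists_swap ha hy h
      refine step a' ha' b hb j (by rintro rfl; omega) ?_ ?_
      · rw [add_right_comm, e, add_right_comm]
      · have := sum_dist_lt_of_swap h hj e
        omega
    · have h : z i < b i := by omega
      obtain ⟨j, hj, b', hb', e⟩ := hB.exists_swap hb hz h
      refine step a ha b' hb' j (by rintro rfl; omega) ?_ ?_
      · rw [add_assoc, e, add_assoc]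
      · have := sum_dist_lt_of_swap h hj e
        omega

variable {K : Type*} [Field K]

lemma monomial_mem_span_iff {A : Set (V →₀ ℕ)} {b : V →₀ ℕ} :
    monomial b (1 : K) ∈ Ideal.span ((fun a => monomial a (1 : K)) '' A) ↔ ∃ a ∈ A, a ≤ b := by
  classical
  rw [mem_ideal_span_monomial_image]
  simp [support_monomial]

/-- Distinct monomials of the same degree never divide each other. -/
lemma minimalMonomials_span {A : Set (V →₀ ℕ)} {d : ℕ} (hd : ∀ a ∈ A, a.degree = d) :
    minimalMonomials (Ideal.span ((fun a => monomial a (1 : K)) '' A)) = A := by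
  have heq : ∀ a ∈ A, ∀ b ∈ A, a ≤ b → a = b := by
    intro a ha b hb hab
    have h := congrArg Finsupp.degree (tsub_add_cancel_of_le hab)
    rw [map_add, hd a ha, hd b hb] at h
    have h0 : (b - a).degree = 0 := by omega
    rw [Finsupp.degree_eq_zero_iff] at h0
    exact le_antisymm hab (tsub_eq_zero_iff_le.1 h0)
  ext b
  simp only [minimalMonomials, Set.mem_ofPred_eq, monomial_mem_span_iff]
  constructor
  · rintro ⟨⟨a, ha, hab⟩, hmin⟩
    rwa [le_antisymm (hmin ⟨a, ha, le_rfl⟩ hab) hab]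
  · refine fun hb => ⟨⟨b, hb, le_rfl⟩, ?_⟩
    rintro c ⟨a, ha, hac⟩ hcb
    rw [← heq a ha b hb (hac.trans hcb)]
    exact hac

lemma isPolymatroidal_span {A : Set (V →₀ ℕ)} {d : ℕ} (hd : ∀ a ∈ A, a.degree = d)
    (hA : ExchangeProperty A) :
    IsPolymatroidal (Ideal.span ((fun a => monomial a (1 : K)) '' A)) := by
  refine ⟨⟨A, rfl⟩, ?_, ?_⟩ <;> rw [minimalMonomials_span hd]
  exacts [⟨d, hd⟩, hA]

open Pointwise in
lemma exists_exchangeProperty_span_pow [Finite V] {A : Set (V →₀ ℕ)} {d : ℕ} (hfin : A.Finite)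
    (hd : ∀ a ∈ A, a.degree = d) (hA : ExchangeProperty A) (q : ℕ) :
    ∃ B : Set (V →₀ ℕ), B.Finite ∧ (∃ e, ∀ a ∈ B, a.degree = e) ∧ ExchangeProperty B ∧
      Ideal.span ((fun a => monomial a (1 : K)) '' A) ^ q =
        Ideal.span ((fun a => monomial a (1 : K)) '' B) := by
  induction q with
  | zero =>
    refine ⟨{0}, Set.finite_singleton _, ⟨0, by simp⟩, ?_, by simp⟩
    rintro _ rfl _ rfl i hi
    simp at hi
  | succ q ih =>
    obtain ⟨B, hBfin, ⟨e, he⟩, hB, hspan⟩ := ih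
    refine ⟨B + A, hBfin.add hfin, ⟨e + d, ?_⟩, hB.add hA, ?_⟩
    · rintro _ ⟨a, ha, b, hb, rfl⟩
      simp [he a ha, hd b hb]
    · rw [pow_succ, hspan, Ideal.span_mul_span']
      congr 1
      ext f
      simp only [Set.mem_mul, Set.mem_image, Set.mem_add]
      constructor
      · rintro ⟨_, ⟨a, ha, rfl⟩, _, ⟨b, hb, rfl⟩, rfl⟩
        exact ⟨a + b, ⟨a, ha, b, hb, rfl⟩, by simp [monomial_mul]⟩
      · rintro ⟨_, ⟨a, ha, b, hb, rfl⟩, rfl⟩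
        exact ⟨_, ⟨a, ha, rfl⟩, _, ⟨b, hb, rfl⟩, by simp [monomial_mul]⟩

end Exchange

/-! ### Linear quotients -/

section LinearQuotients

variable {K : Type*} [Field K] {V : Type*}

lemma mul_monomial_one_mem_span_iff {A : Set (V →₀ ℕ)} {b : V →₀ ℕ} {c : MvPolynomial V K} :
    c * monomial b 1 ∈ Ideal.span ((fun a => monomial a (1 : K)) '' A) ↔
      ∀ m ∈ c.support, ∃ a ∈ A, a ≤ m + b := by
  classical
  rw [mem_ideal_span_monomial_image]
  constructor
  · intro h m hm
    refine h (m + b) ?_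
    rw [mem_support_iff] at hm ⊢
    rwa [coeff_mul_monomial, mul_one]
  · intro h m hm
    rw [mem_support_iff, coeff_mul_monomial'] at hm
    split_ifs at hm with hbm
    · obtain ⟨a, ha, hab⟩ := h (m - b) (by rw [mem_support_iff]; simpa using hm)
      exact ⟨a, ha, by rwa [tsub_add_cancel_of_le hbm] at hab⟩
    · exact absurd rfl hm

/-- The ideal of a finite set of monomials with the exchange property has linear quotients, hence
a linear resolution. -/
theorem ExchangeProperty.exists_isLinearIdeal [Finite V] {B : Set (V →₀ ℕ)} {d : ℕ}
    (hfin : B.Finite) (hd : ∀ a ∈ B, a.degree = d) (hB : ExchangeProperty B) :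
    ∃ p, IsLinearIdeal p d (Ideal.span ((fun a => monomial a (1 : K)) '' B)) := by
  classical
  have := Fintype.ofFinite V
  let _ : LinearOrder V := LinearOrder.lift' (Fintype.equivFin V) (Fintype.equivFin V).injective
  -- Induction over the lexicographic initial segments of `B`.
  suffices H : ∀ S : Finset (V →₀ ℕ), (S : Set (V →₀ ℕ)) ⊆ B →
      (∀ b ∈ S, ∀ a ∈ B, toLex a < toLex b → a ∈ S) →
      ∃ p, IsLinearIdeal p d (Ideal.span ((fun a => monomial a (1 : K)) '' (S : Set (V →₀ ℕ)))) by
    obtain ⟨p, hp⟩ := H hfin.toFinset (by simp) (fun b _ a ha _ => by simpa using ha)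
    exact ⟨p, by simpa using hp⟩
  intro S
  induction S using Finset.induction_on_max_value (toLex : (V →₀ ℕ) → Lex (V →₀ ℕ)) with
  | empty => exact fun _ _ => ⟨0, by simpa using isLinearIdeal_bot 0 d⟩
  | insert b S hbS hmax ih =>
    intro hSB hinit
    rw [Finset.coe_insert, Set.insert_subset_iff] at hSB
    have hlt : ∀ a ∈ S, toLex a < toLex b := fun a ha =>
      lt_of_le_of_ne (hmax a ha) fun h => hbS (toLex.injective h ▸ ha)
    have hmemS : ∀ a ∈ B, toLex a < toLex b → a ∈ S := fun a ha hab =>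
      (Finset.mem_insert.1 (hinit b (Finset.mem_insert_self _ _) a ha hab)).resolve_left
        (fun h => hab.ne (congrArg _ h))
    obtain ⟨p, hp⟩ := ih hSB.2 fun c hc a ha hac => hmemS a ha (hac.trans (hlt c hc))
    -- The variables lying in the colon ideal of the earlier generators by `x^b`; they will turn out
    -- to generate it.
    let T : Finset V := Finset.univ.filter fun i => ∃ a ∈ S, a ≤ b + Finsupp.single i 1
    obtain ⟨p', hp'⟩ := isLinearIdeal_span_X (K := K) T
    refine ⟨max p p' + 1, ?_⟩
    rw [Finset.coe_insert, Set.image_insert_eq, Set.insert_eq, Ideal.span_union,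
      sup_comm (Ideal.span _)]
    have hp₁ := hp.mono (show p ≤ max p p' + 1 by omega)
    have hp₂ := hp'.mono (le_max_right p p')
    have hw : (monomial b (1 : K)).IsHomogeneous d := isHomogeneous_monomial _ (hd b hSB.1)
    refine hp₁.sup_span hw hp₂ fun c => ?_
    rw [mem_ideal_span_X_image, mul_monomial_one_mem_span_iff]
    refine forall₂_congr fun m _ => ?_
    constructor
    · rintro ⟨i, hi, hmi⟩
      obtain ⟨a, ha, hab⟩ := (Finset.mem_filter.1 hi).2
      refine ⟨a, ha, hab.trans ?_⟩
      rw [add_comm]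
      gcongr
      rw [Finsupp.single_le_iff]
      omega
    · rintro ⟨a, ha, hab⟩
      -- At the first difference `j`, `a j < b j`. Exchange gives `a' = b - e_j + e_i` with `b i < a
      -- i`, hence `j < i` and `a'` precedes `b`. So `i ∈ T`, while `b i < a i ≤ m i + b i` shows
      -- that `X i` divides `x^m`.
      obtain ⟨j, heq, hj⟩ := Finsupp.Lex.lt_iff.1 (hlt a ha)
      simp only [ofLex_toLex] at heq hj
      obtain ⟨i, hi, a', ha', e⟩ := hB.exists_swap hSB.1 (hSB.2 ha) hj
      have hsw := swap_apply e
      have hij : j < i := by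
        rcases lt_trichotomy i j with h | h | h
        · have := heq i h
          omega
        · subst h; omega
        · exact h
      refine ⟨i, Finset.mem_filter.2 ⟨Finset.mem_univ _, a', hmemS a' ha' ?_, ?_⟩, ?_⟩
      · refine Finsupp.Lex.lt_iff.2 ⟨j, fun k hk => ?_, ?_⟩
        · have := hsw k
          simpa [hk.ne', (hk.trans hij).ne'] using this
        · have := hsw j
          simp [hij.ne'] at this
          simp only [ofLex_toLex]
          omega
      · rw [← e]
        exact le_self_add
      · have := hab i
        simp only [Finsupp.add_apply] at this
        omega

end LinearQuotients

/-! ### From iterated syzygies to matrices -/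

section GradedFreeResolution

variable {K : Type*} [Field K] {V : Type*}

lemma mulVecLin_transpose_eq {m n : ℕ} (g : Fin n → Fin m → MvPolynomial V K) :
    (Matrix.of fun i k => g k i : Matrix (Fin m) (Fin n) (MvPolynomial V K)).mulVecLin =
      Fintype.linearCombination (MvPolynomial V K) g := by
  refine LinearMap.ext fun c => funext fun i => ?_
  simp [Fintype.linearCombination_apply, Matrix.mulVec, dotProduct, mul_comm]

lemma range_linearCombination_comp_equiv {ι κ : Type} [Fintype ι] [Fintype κ] (σ : ι ≃ κ)
    {M : Type*} [AddCommGroup M] [Module (MvPolynomial V K) M] (g : κ → M) :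
    LinearMap.range (Fintype.linearCombination (MvPolynomial V K) (g ∘ σ)) =
      LinearMap.range (Fintype.linearCombination (MvPolynomial V K) g) := by
  rw [Fintype.range_linearCombination, Fintype.range_linearCombination, σ.surjective.range_comp]

/-- Renaming the coordinates of the ambient free module. -/
lemma HasLinearSyzygies.comap_equiv {p : ℕ} {ι κ : Type} (σ : ι ≃ κ) {e : ℕ}
    {N : Submodule (MvPolynomial V K) (κ → MvPolynomial V K)} (h : HasLinearSyzygies p N e) :
    HasLinearSyzygies p (N.map (LinearMap.funLeft (MvPolynomial V K) (MvPolynomial V K) σ)) e := by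
  cases p with
  | zero =>
    change N = ⊥ at h
    change _ = ⊥
    rw [h, Submodule.map_bot]
  | succ p =>
    obtain ⟨τ, _, g, hg, rfl, hk⟩ := h
    have hcomp : Fintype.linearCombination (MvPolynomial V K) (fun k => g k ∘ σ) =
        (LinearMap.funLeft (MvPolynomial V K) (MvPolynomial V K) σ) ∘ₗ
          Fintype.linearCombination (MvPolynomial V K) g := by
      refine LinearMap.ext fun c => funext fun i => ?_
      simp [Fintype.linearCombination_apply, LinearMap.funLeft_apply]
    refine ⟨τ, inferInstance, fun k => g k ∘ σ, fun k i => hg k (σ i), ?_, ?_⟩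
    · rw [hcomp, LinearMap.range_comp]
    · rw [hcomp, LinearMap.ker_comp_of_ker_eq_bot]
      · exact hk
      · exact LinearMap.ker_eq_bot.2 (LinearMap.funLeft_injective_of_surjective _ _ _ σ.surjective)

lemma ker_linearCombination_comp_equiv {ι κ : Type} [Fintype ι] [Fintype κ] (σ : ι ≃ κ)
    {M : Type*} [AddCommGroup M] [Module (MvPolynomial V K) M] (g : κ → M) :
    LinearMap.ker (Fintype.linearCombination (MvPolynomial V K) (g ∘ σ)) =
      (LinearMap.ker (Fintype.linearCombination (MvPolynomial V K) g)).map
        (LinearMap.funLeft (MvPolynomial V K) (MvPolynomial V K) σ) := by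
  ext c
  simp only [Submodule.mem_map, LinearMap.mem_ker, Fintype.linearCombination_apply]
  constructor
  · intro h
    refine ⟨c ∘ σ.symm, ?_, by ext1 i; simp [LinearMap.funLeft_apply]⟩
    rw [← h, ← σ.sum_comp]
    simp
  · rintro ⟨d, h, rfl⟩
    rw [← h, ← σ.sum_comp]
    rfl

/-- The matrices of a linear resolution of a submodule `N` of `R^n`. -/
lemma HasLinearSyzygies.exists_matrices {p n : ℕ}
    {N : Submodule (MvPolynomial V K) (Fin n → MvPolynomial V K)}
    (h : HasLinearSyzygies p N 1) :
    ∃ (rank : ℕ → ℕ)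
      (D₀ : Matrix (Fin n) (Fin (rank 0)) (MvPolynomial V K))
      (D : (i : ℕ) → Matrix (Fin (rank i)) (Fin (rank (i + 1))) (MvPolynomial V K)),
      (∀ k l, (D₀ k l).IsHomogeneous 1) ∧ (∀ i k l, (D i k l).IsHomogeneous 1) ∧
      LinearMap.range D₀.mulVecLin = N ∧
      LinearMap.range (D 0).mulVecLin = LinearMap.ker D₀.mulVecLin ∧
      (∀ i, LinearMap.range (D (i + 1)).mulVecLin = LinearMap.ker (D i).mulVecLin) ∧
      ∀ i, p ≤ i → rank i = 0 := by
  induction p generalizing n with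
  | zero =>
    change N = ⊥ at h
    subst h
    refine ⟨fun _ => 0, 0, fun _ => 0, fun _ l => l.elim0, fun _ k => k.elim0, ?_, ?_, ?_,
      fun _ _ => rfl⟩
    · simp
    · exact Subsingleton.elim _ _
    · exact fun _ => Subsingleton.elim _ _
  | succ p ih =>
    obtain ⟨κ, _, g, hg, rfl, hk⟩ := h
    let σ := (Fintype.equivFin κ).symm
    obtain ⟨rank, D₀, D, h1, h2, h3, h4, h5, h6⟩ := ih (hk.comap_equiv σ)
    rw [← ker_linearCombination_comp_equiv] at h3
    -- The generators of `N` become the new `D₀`; the matrices of their syzygies move up by one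
    -- index.
    refine ⟨fun i => Nat.casesOn i (Fintype.card κ) rank, Matrix.of fun i k => g (σ k) i,
      fun i => match i with
        | 0 => D₀
        | i + 1 => D i, fun k l => hg _ _, ?_, ?_, ?_, ?_, ?_⟩
    · rintro (_ | i) k l
      exacts [h1 k l, h2 i k l]
    · rw [← range_linearCombination_comp_equiv σ, ← mulVecLin_transpose_eq]
      rfl
    · refine h3.trans ?_
      rw [← mulVecLin_transpose_eq]
      rfl
    · rintro (_ | i)
      exacts [h4, h5 i]
    · rintro (_ | i) hi
      exacts [by omega, h6 i (by omega)]

/-- An ideal with linear syzygies has a linear resolution. -/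
theorem IsLinearIdeal.hasLinearResolution {p d : ℕ} {I : Ideal (MvPolynomial V K)}
    (h : IsLinearIdeal p d I) : HasLinearResolution I := by
  obtain ⟨ι, _, u, hu, rfl, hk⟩ := h
  let σ := (Fintype.equivFin ι).symm
  obtain ⟨rank, D₀, D, h1, h2, h3, h4, h5, h6⟩ := (hk.comap_equiv σ).exists_matrices
  rw [← ker_linearCombination_comp_equiv] at h3
  -- Minimality: linear forms have no constant term.
  have hconst : ∀ f : MvPolynomial V K, f.IsHomogeneous 1 → constantCoeff f = 0 := by
    intro f hf
    rw [constantCoeff_eq]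
    exact hf.coeff_eq_zero (by simp)
  refine ⟨d, ⟨fun i => Nat.casesOn i (Fintype.card ι) rank, fun i _ => d + i, u ∘ σ,
    fun i => match i with
      | 0 => D₀
      | i + 1 => D i, fun k => hu _, ?_, ?_, h3, ?_, p, ?_⟩, ?_, fun _ _ => rfl⟩
  · rintro (_ | i) k l
    exacts [.inr ⟨1, rfl, h1 k l⟩, .inr ⟨1, rfl, h2 i k l⟩]
  · rw [σ.surjective.range_comp]
  · rintro (_ | i)
    exacts [h4, h5 i]
  · rintro (_ | i) hi
    exacts [by omega, h6 i (by omega)]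
  · rintro (_ | i) k l
    exacts [hconst _ (h1 k l), hconst _ (h2 i k l)]

end GradedFreeResolution

/-! ### Connected vertex sets and matroid bases -/

section ConnectedSets

variable {V : Type*}

/-- Paths of length at most 3 suffice for all the graphs considered; length 3 is needed only for
complements of cycles. -/
lemma induce_connected_of_paths {G : SimpleGraph V} {S : Finset V} (hS : S.Nonempty)
    (h : ∀ u ∈ S, ∀ v ∈ S, u ≠ v → ¬ G.Adj u v → ∃ w ∈ S, ∃ w' ∈ S,
      G.Adj u w ∧ G.Adj w' v ∧ (w = w' ∨ G.Adj w w')) :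
    (G.induce (S : Set V)).Connected := by
  have adj : ∀ u (hu : u ∈ S) v (hv : v ∈ S), G.Adj u v →
      (G.induce (S : Set V)).Reachable ⟨u, hu⟩ ⟨v, hv⟩ :=
    fun u hu v hv huv => SimpleGraph.Adj.reachable (by simpa using huv)
  rw [SimpleGraph.connected_iff]
  refine ⟨?_, hS.to_subtype⟩
  rintro ⟨u, hu⟩ ⟨v, hv⟩
  by_cases huv : u = v
  · subst huv; rfl
  by_cases ha : G.Adj u v
  · exact adj u hu v hv ha
  obtain ⟨w, hw, w', hw', h1, h2, h3⟩ := h u hu v hv huv ha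
  refine (adj u hu w hw h1).trans (.trans ?_ (adj w' hw' v hv h2))
  rcases h3 with rfl | h3
  · rfl
  · exact adj w hw w' hw' h3

/-- The obstruction to connectedness: a function constant along edges is constant on a connected
set. -/
lemma eq_of_induce_connected {α : Type*} {G : SimpleGraph V} {S : Finset V}
    (hS : (G.induce (S : Set V)).Connected) (c : V → α)
    (hc : ∀ u ∈ S, ∀ v ∈ S, G.Adj u v → c u = c v) {u v : V} (hu : u ∈ S) (hv : v ∈ S) :
    c u = c v := by
  obtain ⟨p⟩ := hS.preconnected ⟨u, hu⟩ ⟨v, hv⟩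
  suffices H : ∀ a b : (S : Set V), (G.induce (S : Set V)).Walk a b → c a = c b from H _ _ p
  intro a b p
  induction p with
  | nil => rfl
  | @cons a b _ h _ ih => exact (hc _ a.2 _ b.2 (by simpa using h)).trans ih

/-- The exchange axiom of a matroid, for a family of bases. -/
def BasisExchange (F : Finset V → Prop) : Prop :=
  ∀ S T, F S → F T → ∀ i ∈ S, i ∉ T →
    ∃ j ∈ T, ∃ S', j ∉ S ∧ F S' ∧ ∀ v, v ∈ S' ↔ v = j ∨ v ∈ S ∧ v ≠ i

/-- The `s`-subsets on which a given map is not constant are the bases of a matroid. -/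
lemma basisExchange_nonconstant {α : Type*} (c : V → α) {s : ℕ} (hs : 2 ≤ s) :
    BasisExchange fun S => S.card = s ∧ ∃ u ∈ S, ∃ v ∈ S, c u ≠ c v := by
  classical
  rintro S T ⟨hSc, hS⟩ ⟨hTc, u, hu, v, hv, huv⟩ i hi hiT
  have hcard : ∀ j, j ∉ S → (insert j (S.erase i)).card = s := by
    intro j hj
    rw [Finset.card_insert_of_notMem (fun h => hj (Finset.mem_of_mem_erase h)),
      Finset.card_erase_of_mem hi]
    omega
  have hmem : ∀ j v, v ∈ insert j (S.erase i) ↔ v = j ∨ v ∈ S ∧ v ≠ i := by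
    intro j v
    rw [Finset.mem_insert, Finset.mem_erase, and_comm]
  -- If `S \ {i}` is already nonconstant, any `j ∈ T \ S` works. Otherwise `c` has one value on it,
  -- and `T` contains some `j` with another value, necessarily outside `S`.
  by_cases hconst : ∃ x ∈ S.erase i, ∃ y ∈ S.erase i, c x ≠ c y
  · obtain ⟨x, hx, y, hy, hxy⟩ := hconst
    obtain ⟨j, hj, hjS⟩ : ∃ j ∈ T, j ∉ S := by
      by_contra! h
      exact hiT (Finset.eq_of_subset_of_card_le h (by omega) ▸ hi)
    exact ⟨j, hj, _, hjS, ⟨hcard j hjS, x, Finset.mem_insert_of_mem hx, y,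
      Finset.mem_insert_of_mem hy, hxy⟩, hmem j⟩
  · push Not at hconst
    obtain ⟨x, hx⟩ : (S.erase i).Nonempty := by
      rw [← Finset.card_pos, Finset.card_erase_of_mem hi]
      omega
    obtain ⟨j, hj, hjx⟩ : ∃ j ∈ T, c j ≠ c x := by
      by_contra! h
      exact huv ((h u hu).trans (h v hv).symm)
    have hjS : j ∉ S := by
      intro hjS
      have hji : j ≠ i := fun h => hiT (h ▸ hj)
      exact hjx (hconst j (Finset.mem_erase.2 ⟨hji, hjS⟩) x hx)
    exact ⟨j, hj, _, hjS, ⟨hcard j hjS, j, Finset.mem_insert_self _ _, x,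
      Finset.mem_insert_of_mem hx, hjx⟩, hmem j⟩

/-! ### The three families of graphs -/

lemma basisExchange_connected_of_iff {α : Type*} {G : SimpleGraph V} {r : ℕ} (hr : 1 ≤ r)
    (c : V → α) (h : ∀ S : Finset V, S.card = r + 1 →
      ((G.induce (S : Set V)).Connected ↔ ∃ u ∈ S, ∃ v ∈ S, c u ≠ c v)) :
    BasisExchange fun S : Finset V => S.card = r + 1 ∧ (G.induce (S : Set V)).Connected := by
  have := basisExchange_nonconstant c (s := r + 1) (by omega)
  rwa [show (fun S : Finset V => S.card = r + 1 ∧ (G.induce (S : Set V)).Connected) =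
    fun S => S.card = r + 1 ∧ ∃ u ∈ S, ∃ v ∈ S, c u ≠ c v from
    funext fun S => propext (and_congr_right (h S))]

lemma basisExchange_of_forall_not {F : Finset V → Prop} (h : ∀ S, ¬ F S) : BasisExchange F :=
  fun S _ hS => (h S hS).elim

lemma basisExchange_connected_of_multipartite {α : Type*} {G : SimpleGraph V} {r : ℕ}
    (hr : 1 ≤ r) (c : V → α) (h : ∀ u v, G.Adj u v ↔ c u ≠ c v) :
    BasisExchange fun S : Finset V => S.card = r + 1 ∧ (G.induce (S : Set V)).Connected := by
  refine basisExchange_connected_of_iff hr c fun S hS => ⟨fun hconn => ?_, ?_⟩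
  · obtain ⟨u, hu, v, hv, huv⟩ := Finset.one_lt_card.1 (show 1 < S.card by omega)
    by_contra! hc
    exact huv (eq_of_induce_connected hconn id
      (fun x hx y hy hxy => ((h x y).1 hxy (hc x hx y hy)).elim) hu hv)
  · rintro ⟨x, hx, y, hy, hxy⟩
    refine induce_connected_of_paths ⟨x, hx⟩ fun u hu v hv _ hadj => ?_
    simp only [h, not_not] at hadj ⊢
    by_cases hux : c u = c x
    · exact ⟨y, hy, y, hy, hux ▸ hxy, by rw [← hadj, hux]; exact hxy.symm, .inl rfl⟩
    · exact ⟨x, hx, x, hx, hux, by rw [← hadj]; exact Ne.symm hux, .inl rfl⟩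

lemma cycleGraph_adj_iff_val {n : ℕ} (hn : 3 ≤ n) (u v : Fin n) :
    (SimpleGraph.cycleGraph n).Adj u v ↔
      u.val + 1 = v.val ∨ v.val + 1 = u.val ∨ (u.val = 0 ∧ v.val + 1 = n) ∨
        (v.val = 0 ∧ u.val + 1 = n) := by
  rw [SimpleGraph.cycleGraph_adj']
  have key : ∀ a b : Fin n, (a - b).val = 1 ↔
      b.val + 1 = a.val ∨ (a.val = 0 ∧ b.val + 1 = n) := by
    intro a b
    have ha := a.2
    have hb := b.2
    rw [Fin.sub_def]
    simp only
    rcases lt_or_ge a.val b.val with h | h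
    · rw [Nat.mod_eq_of_lt (by omega)]
      omega
    · rw [show n - b.val + a.val = (a.val - b.val) + n by omega, Nat.add_mod_right,
        Nat.mod_eq_of_lt (by omega)]
      omega
  rw [key, key]
  omega

/-- Adjacency in the cycle of length `n` with vertices `0, …, n - 1`. -/
def CycleAdj (n a b : ℕ) : Prop :=
  a + 1 = b ∨ b + 1 = a ∨ (a = 0 ∧ b + 1 = n) ∨ (b = 0 ∧ a + 1 = n)

lemma CycleAdj.symm {n a b : ℕ} (h : CycleAdj n a b) : CycleAdj n b a := by
  unfold CycleAdj at *
  omega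

/-- Vertices of a cycle have degree at most two. -/
lemma CycleAdj.eq_of_two_neighbors {n a b c d : ℕ} (_ : a < n) (hb : b < n) (hc : c < n)
    (hd : d < n) (h₁ : CycleAdj n a b) (h₂ : CycleAdj n a c) (h₃ : CycleAdj n a d)
    (hbc : b ≠ c) (hbd : b ≠ d) : c = d := by
  unfold CycleAdj at *
  rcases h₁ with h₁ | h₁ | h₁ | h₁ <;> rcases h₂ with h₂ | h₂ | h₂ | h₂ <;> omega

/-- `a, b, d, c` would be a 4-cycle, which `C_n` does not contain for `n ≥ 5`. -/
lemma CycleAdj.not_square {n a b c d : ℕ} (hn : 5 ≤ n) (ha : a < n) (hb : b < n) (hc : c < n)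
    (hd : d < n) (h₁ : CycleAdj n a b) (h₂ : CycleAdj n a c) (h₃ : CycleAdj n b d)
    (hbc : b ≠ c) (had : a ≠ d) : ¬ CycleAdj n c d := by
  unfold CycleAdj at *
  rcases h₁ with h₁ | h₁ | h₁ | h₁ <;> rcases h₂ with h₂ | h₂ | h₂ | h₂ <;>
    rcases h₃ with h₃ | h₃ | h₃ | h₃ <;> omega

lemma basisExchange_connected_of_compl_cycle {G : SimpleGraph V} {r n : ℕ} (hr : 3 ≤ r)
    (hn : 3 ≤ n) (f : G ≃g (SimpleGraph.cycleGraph n)ᶜ) :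
    BasisExchange fun S : Finset V => S.card = r + 1 ∧ (G.induce (S : Set V)).Connected := by
  classical
  have hadj : ∀ u v, G.Adj u v ↔ (f u).val ≠ (f v).val ∧
      ¬ CycleAdj n (f u).val (f v).val := by
    intro u v
    rw [CycleAdj, ← cycleGraph_adj_iff_val hn, Fin.val_ne_iff, ← f.map_adj_iff, SimpleGraph.compl_adj]
  have hinj : ∀ u v, (f u).val = (f v).val → u = v :=
    fun u v h => f.injective (Fin.val_injective h)
  have hlt : ∀ u, (f u).val < n := fun u => (f u).2
  have hcard : ∀ S : Finset V, S.card ≤ n := by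
    intro S
    have := Finset.card_le_univ (S.map f.toEquiv.toEmbedding)
    simpa using this
  rcases Nat.lt_or_ge 4 n with h5 | h4
  · refine basisExchange_connected_of_iff (by omega) id fun S hS => ⟨fun _ => ?_, fun _ => ?_⟩
    · obtain ⟨u, hu, v, hv, huv⟩ := Finset.one_lt_card.1 (show 1 < S.card by omega)
      exact ⟨u, hu, v, hv, huv⟩
    · refine induce_connected_of_paths (Finset.card_pos.1 (by omega)) fun u hu v hv huv hadj' => ?_
      have hcard2 : 1 < ((S.erase u).erase v).card := by
        rw [Finset.card_erase_of_mem (Finset.mem_erase.2 ⟨huv.symm, hv⟩),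
          Finset.card_erase_of_mem hu]
        omega
      obtain ⟨w, hw, w', hw', hww⟩ := Finset.one_lt_card.1 hcard2
      simp only [Finset.mem_erase] at hw hw'
      obtain ⟨hwv, hwu, hwS⟩ := hw
      obtain ⟨hwv', hwu', hwS'⟩ := hw'
      have hval : ∀ {a b}, a ≠ b → (f a).val ≠ f b := fun h h' => h (hinj _ _ h')
      have hD : ∀ {a b}, a ≠ b → ¬ G.Adj a b → CycleAdj n (f a) (f b) := by
        intro a b hab h
        by_contra h'
        exact h ((hadj a b).2 ⟨hval hab, h'⟩)
      have huv' := hD huv hadj'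
      -- If `a` and `b` are the other cycle neighbours of `u` and `v`, then `u, b, a, v` is a path
      -- in `G`: a missing edge would give a third cycle neighbour or a 4-cycle.
      have key : ∀ a ∈ S, ∀ b ∈ S, a ≠ b → a ≠ u → a ≠ v → b ≠ u → b ≠ v →
          CycleAdj n (f u) (f a) → CycleAdj n (f v) (f b) →
          ∃ x ∈ S, ∃ y ∈ S, G.Adj u x ∧ G.Adj y v ∧ (x = y ∨ G.Adj x y) := by
        intro a ha b hb hab hau hav hbu hbv h1 h2
        refine ⟨b, hb, a, ha, (hadj _ _).2 ⟨hval hbu.symm, fun h => hval hab ?_⟩,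
          (hadj _ _).2 ⟨hval hav, fun h => hval hab ?_⟩,
          .inr ((hadj _ _).2 ⟨hval hab.symm, fun h => ?_⟩)⟩
        · exact huv'.eq_of_two_neighbors (hlt u) (hlt v) (hlt a) (hlt b) h1 h (hval hav.symm)
            (hval hbv.symm)
        · exact huv'.symm.eq_of_two_neighbors (hlt v) (hlt u) (hlt a) (hlt b) h.symm h2
            (hval hau.symm) (hval hbu.symm)
        · exact huv'.not_square h5 (hlt u) (hlt v) (hlt a) (hlt b) h1 h2 (hval hav.symm)
            (hval hbu.symm) h.symm
      by_cases c1 : G.Adj u w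
      · by_cases c2 : G.Adj w v
        · exact ⟨w, hwS, w, hwS, c1, c2, .inl rfl⟩
        by_cases c3 : G.Adj u w'
        · by_cases c4 : G.Adj w' v
          · exact ⟨w', hwS', w', hwS', c3, c4, .inl rfl⟩
          · exact (hval hww (huv'.symm.eq_of_two_neighbors (hlt v) (hlt u) (hlt w) (hlt w')
              (hD hwv c2).symm (hD hwv' c4).symm (hval hwu.symm) (hval hwu'.symm))).elim
        · exact key w' hwS' w hwS hww.symm hwu' hwv' hwu hwv (hD hwu'.symm c3) (hD hwv c2).symm
      · by_cases c3 : G.Adj u w'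
        · by_cases c4 : G.Adj w' v
          · exact ⟨w', hwS', w', hwS', c3, c4, .inl rfl⟩
          · exact key w hwS w' hwS' hww hwu hwv hwu' hwv' (hD hwu.symm c1) (hD hwv' c4).symm
        · exact (hval hww (huv'.eq_of_two_neighbors (hlt u) (hlt v) (hlt w) (hlt w')
            (hD hwu.symm c1) (hD hwu'.symm c3) (hval hwv.symm) (hval hwv'.symm))).elim
  · apply basisExchange_of_forall_not
    rintro S ⟨hS, hconn⟩
    have hn4 : n = 4 := by
      have := hcard S
      omega
    have huniv : ∀ x : Fin n, f.symm x ∈ S := by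
      intro x
      have : S.map f.toEquiv.toEmbedding = Finset.univ := by
        rw [← Finset.card_eq_iff_eq_univ, Finset.card_map, Fintype.card_fin]
        have := hcard S
        omega
      have hx := Finset.mem_univ x
      rw [← this, Finset.mem_map] at hx
      obtain ⟨y, hy, rfl⟩ := hx
      simpa using hy
    -- The complement of `C_4` is two disjoint edges, joining vertices of equal parity.
    have h01 := eq_of_induce_connected hconn (fun v => (f v).val % 2) ?_
      (huniv ⟨0, by omega⟩) (huniv ⟨1, by omega⟩)
    · simp at h01
    · intro u _ v _ huv
      rw [hadj, CycleAdj] at huv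
      have := hlt u
      have := hlt v
      omega

lemma basisExchange_connected_of_glued {G : SimpleGraph V} {r p n : ℕ} {m : Fin n → ℕ}
    (hr : 1 ≤ r) (hm : ∀ i, m i ≤ r) (f : G ≃g gluedCompleteGraph p m) :
    BasisExchange fun S : Finset V => S.card = r + 1 ∧ (G.induce (S : Set V)).Connected := by
  classical
  have hadj : ∀ u v, G.Adj u v ↔ f u ≠ f v ∧
      ∃ i, f u ∈ gluedClique p m i ∧ f v ∈ gluedClique p m i :=
    fun u v => f.map_adj_iff.symm
  rcases isEmpty_or_nonempty (Fin n) with hn | hn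
  -- With no cliques to glue there are no edges at all, even among the `x_k`.
  · apply basisExchange_of_forall_not
    rintro S ⟨hS, hconn⟩
    obtain ⟨u, hu, v, hv, huv⟩ := Finset.one_lt_card.1 (show 1 < S.card by omega)
    refine huv (eq_of_induce_connected hconn id (fun x hx y hy hxy => ?_) hu hv)
    obtain ⟨_, i, _⟩ := (hadj x y).1 hxy
    exact hn.elim i
  have hinl : ∀ k i, (Sum.inl k : Fin p ⊕ (Σ i : Fin n, Fin (m i))) ∈ gluedClique p m i :=
    fun k i => .inl ⟨k, rfl⟩
  have hinr : ∀ i j i', (Sum.inr ⟨i, j⟩ : Fin p ⊕ (Σ i : Fin n, Fin (m i))) ∈ gluedClique p m i' ↔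
      i = i' := by
    intro i j i'
    constructor
    · rintro (⟨k, hk⟩ | ⟨k, hk⟩)
      · cases hk
      · cases hk; rfl
    · rintro rfl
      exact .inr ⟨j, rfl⟩
  have hall : ∀ x k, ∃ i, x ∈ gluedClique p m i ∧ Sum.inl k ∈ gluedClique p m i := by
    rintro (l | ⟨i, j⟩) k
    · exact ⟨hn.some, hinl _ _, hinl _ _⟩
    · exact ⟨i, (hinr _ _ _).2 rfl, hinl _ _⟩
  -- `c` sends `x_k` to `some k` and every `y_{ij}` to `none`. A connected `S` with `c` constant
  -- would lie in one block of `y`'s, which has at most `r` elements; otherwise `S` contains some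
  -- `x_k`, adjacent to all other vertices.
  refine basisExchange_connected_of_iff hr (fun v => (f v).getLeft?) fun S hS => ⟨fun hconn => ?_, ?_⟩
  · obtain ⟨u, hu, v, hv, huv⟩ := Finset.one_lt_card.1 (show 1 < S.card by omega)
    by_contra! hc
    have hY : ∀ x ∈ S, ∃ y, f x = Sum.inr y := by
      intro x hx
      rcases hfx : f x with k | y
      · have key : ∀ z ∈ S, f z = Sum.inl k := by
          intro z hz
          have := hc z hz x hx
          simpa [hfx, Sum.getLeft?_eq_some_iff] using this
        exact (huv (f.injective ((key u hu).trans (key v hv).symm))).elim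
      · exact ⟨y, rfl⟩
    obtain ⟨⟨i, j⟩, hfu⟩ := hY u hu
    have hi : ∀ x ∈ S, ∃ j, f x = Sum.inr ⟨i, j⟩ := by
      intro x hx
      have hcl : x ∈ S → ∀ i', f x ∈ gluedClique p m i' ↔ f u ∈ gluedClique p m i' := by
        intro hx i'
        have := eq_of_induce_connected hconn (fun z => f z ∈ gluedClique p m i') ?_ hx hu
        · exact iff_of_eq this
        · intro a ha b hb hab
          obtain ⟨⟨ia, ja⟩, hfa⟩ := hY a ha
          obtain ⟨⟨ib, jb⟩, hfb⟩ := hY b hb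
          obtain ⟨_, i'', h1, h2⟩ := (hadj a b).1 hab
          rw [hfa, hinr] at h1
          rw [hfb, hinr] at h2
          simp only [hfa, hfb, hinr, h1, h2]
      obtain ⟨⟨i', j'⟩, hfx⟩ := hY x hx
      have := (hcl hx i).2 (by rw [hfu, hinr])
      rw [hfx, hinr] at this
      subst this
      exact ⟨j', hfx⟩
    have hle : S.card ≤ (Finset.univ : Finset (Fin (m i))).card := by
      refine Finset.card_le_card_of_surjOn (fun j => f.symm (Sum.inr ⟨i, j⟩)) fun x hx => ?_
      obtain ⟨j, hj⟩ := hi x hx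
      exact ⟨j, by simp, by simp [← hj]⟩
    have := hm i
    simp at hle
    omega
  · rintro ⟨x, hx, y, hy, hxy⟩
    obtain ⟨z, hz, k, hk⟩ : ∃ z ∈ S, ∃ k, f z = Sum.inl k := by
      rcases hfx : f x with k | _
      · exact ⟨x, hx, k, hfx⟩
      rcases hfy : f y with k | _
      · exact ⟨y, hy, k, hfy⟩
      · simp [hfx, hfy] at hxy
    refine induce_connected_of_paths ⟨x, hx⟩ fun u hu v hv huv huv' => ?_
    have hadjz : ∀ w, w ≠ z → G.Adj w z := fun w hw =>
      (hadj w z).2 ⟨fun h => hw (f.injective h), hk ▸ hall _ _⟩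
    by_cases huz : u = z
    · subst huz
      exact (huv' (hadjz v huv.symm).symm).elim
    by_cases hvz : v = z
    · subst hvz
      exact (huv' (hadjz u huv)).elim
    exact ⟨z, hz, z, hz, hadjz u huz, (hadjz v hvz).symm, .inl rfl⟩

/-! ### From set families to squarefree monomials, and the theorem -/

lemma sum_single_one_apply [DecidableEq V] (S : Finset V) (v : V) :
    (∑ x ∈ S, Finsupp.single x 1 : V →₀ ℕ) v = if v ∈ S then 1 else 0 := by
  simp [Finsupp.finsetSum_apply, Finsupp.single_apply]

lemma BasisExchange.exchangeProperty {F : Finset V → Prop} (hF : BasisExchange F) :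
    ExchangeProperty {a : V →₀ ℕ | ∃ S, F S ∧ a = ∑ x ∈ S, Finsupp.single x 1} := by
  classical
  apply exchangeProperty_of_exists_swap
  rintro _ ⟨S, hS, rfl⟩ _ ⟨T, hT, rfl⟩ i hi
  simp only [sum_single_one_apply] at hi ⊢
  obtain ⟨hiS, hiT⟩ : i ∈ S ∧ i ∉ T := by
    by_cases h1 : i ∈ S <;> by_cases h2 : i ∈ T <;> simp_all
  obtain ⟨j, hj, S', hjS, hS', hmem⟩ := hF S T hS hT i hiS hiT
  refine ⟨j, by simp [hj, hjS], _, ⟨S', hS', rfl⟩, ?_⟩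
  ext v
  simp only [Finsupp.add_apply, sum_single_one_apply, hmem, Finsupp.single_apply]
  have hij : i ≠ j := fun h => hjS (h ▸ hiS)
  by_cases h1 : v = j
  · subst h1
    simp [hij, hjS]
  · by_cases h2 : v = i
    · subst h2
      simp [hiS, h1, Ne.symm h1]
    · simp [h1, h2, Ne.symm h1, Ne.symm h2]

lemma connectedIdeal_eq_span_monomial (K : Type*) [Field K] (G : SimpleGraph V) (r : ℕ) :
    connectedIdeal K G r = Ideal.span ((fun a => monomial a (1 : K)) ''
      {a | ∃ S : Finset V, (S.card = r + 1 ∧ (G.induce (S : Set V)).Connected) ∧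
        a = ∑ x ∈ S, Finsupp.single x 1}) := by
  have h : ∀ S : Finset V, (∏ x ∈ S, X x : MvPolynomial V K) =
      monomial (∑ x ∈ S, Finsupp.single x 1) 1 := fun S => (monomial_sum_one _ _).symm
  unfold connectedIdeal
  congr 1
  ext f
  constructor
  · rintro ⟨S, h1, h2, rfl⟩
    exact ⟨_, ⟨S, ⟨h1, h2⟩, rfl⟩, (h S).symm⟩
  · rintro ⟨_, ⟨S, ⟨h1, h2⟩, rfl⟩, rfl⟩
    exact ⟨S, h1, h2, (h S).symm⟩

end ConnectedSets
theorem mainTheorem5 (K : Type*) [Field K] {V : Type*} [Finite V] (G : SimpleGraph V) (r : ℕ)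
    (h : (1 ≤ r ∧ ∃ (p : ℕ) (n : Fin p → ℕ), (∀ i, 1 ≤ n i) ∧
            Nonempty (G ≃g SimpleGraph.completeMultipartiteGraph (fun i => Fin (n i)))) ∨
         (3 ≤ r ∧ ∃ n : ℕ, 3 ≤ n ∧ Nonempty (G ≃g (SimpleGraph.cycleGraph n)ᶜ)) ∨
         (1 ≤ r ∧ ∃ (p n : ℕ) (m : Fin n → ℕ), 1 ≤ p ∧ (∀ i, 1 ≤ m i) ∧ (∀ i, m i ≤ r) ∧
            Nonempty (G ≃g gluedCompleteGraph p m))) :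
    IsPolymatroidal (connectedIdeal K G r) ∧
      ∀ q : ℕ, 1 ≤ q → HasLinearResolution (connectedIdeal K G r ^ q) := by
  have hF : BasisExchange fun S : Finset V =>
      S.card = r + 1 ∧ (G.induce (S : Set V)).Connected := by
    rcases h with ⟨hr, p, n, _, ⟨f⟩⟩ | ⟨hr, n, hn, ⟨f⟩⟩ | ⟨hr, p, n, m, _, _, hm, ⟨f⟩⟩
    · refine basisExchange_connected_of_multipartite hr (fun v => (f v).1) fun u v => ?_
      rw [← f.map_adj_iff]
      simp
    · exact basisExchange_connected_of_compl_cycle hr hn f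
    · exact basisExchange_connected_of_glued hr hm f
  have hdeg : ∀ a ∈ {a : V →₀ ℕ | ∃ S : Finset V, (S.card = r + 1 ∧
      (G.induce (S : Set V)).Connected) ∧ a = ∑ x ∈ S, Finsupp.single x 1}, a.degree = r + 1 := by
    rintro _ ⟨S, ⟨hS, _⟩, rfl⟩
    simp [map_sum, hS]
  have hfin : {a : V →₀ ℕ | ∃ S : Finset V, (S.card = r + 1 ∧
      (G.induce (S : Set V)).Connected) ∧ a = ∑ x ∈ S, Finsupp.single x 1}.Finite := by
    refine (Set.finite_range fun S : Finset V => ∑ x ∈ S, Finsupp.single x 1).subset ?_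
    rintro _ ⟨S, _, rfl⟩
    exact ⟨S, rfl⟩
  rw [connectedIdeal_eq_span_monomial]
  refine ⟨isPolymatroidal_span hdeg hF.exchangeProperty, fun q _ => ?_⟩
  obtain ⟨B, hB, ⟨d, hd⟩, hBex, hspan⟩ :=
    exists_exchangeProperty_span_pow (K := K) hfin hdeg hF.exchangeProperty q
  rw [hspan]
  obtain ⟨p, hp⟩ := hBex.exists_isLinearIdeal (K := K) hB hd
  exact hp.hasLinearResolution
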